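/- Let $G$ be an undirected graph without loops on the nodes $1,\dots,n$ ($n\ge 1$) that is saturated, i.e. the number $u_{ij}=u_{ji}$ of edges between $i$ and $j$ is positive for all $i\ne j$. Let $d_i=\sum_j u_{ij}$ be the degree of node $i$ and $e$ the number of edges. Let $\mathbb K$ be a field. For $I\subseteq[n-1]=\{1,\dots,n-1\}$ put $\mathbf x^{I\to[n]\setminus I}=\prod_{i\in I}x_i^{\sum_{k\in[n]\setminus I}u_{ik}}$, and let $$M_G=\bigl\langle\,\mathbf x^{I\to[n]\setminus I}\;:\;\emptyset\ne I\subseteq[n-1]\,\bigr\rangle\subseteq\mathbb K[x_1,\dots,x_{n-1}].$$ Let $I_G\subseteq\mathbb K[x_1,\dots,x_n]$ be the toppling ideal of $G$, generated by the binomials $\mathbf x^{\mathbf u}-\mathbf x^{\mathbf v}$ such that $\mathbf u,\mathbf v\in\mathbb N^n$ and $\mathbf u-\mathbf v$ lies in the lattice spanned over $\mathbb Z$ by the columns of the Laplacian matrix of $G$. For a monomial ideal $M$ of $\mathbb K[x_1,\dots,x_m]$, the set $\mathrm{MonSoc}(M)$ of socle monomials consists of the monomials $\mathbf x^{\mathbf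 c}\notin M$ with $x_i\mathbf x^{\mathbf c}\in M$ for all $i$. The ideal $M$ is artinian if $\mathbb K[x_1,\dots,x_m]/M$ is artinian. It is level if all its socle monomials have the same degree, and its genus is then one plus that degree. It is reflection-invariant if it has a canonical monomial, that is, a monomial $\mathbf x^{\mathbf K}$ divisible by every socle monomial such that $\mathbf x^{\mathbf c}\mapsto\mathbf x^{\mathbf K}/\mathbf x^{\mathbf c}$ is an involution of $\mathrm{MonSoc}(M)$. It is Riemann–Roch if it is artinian, level and reflection-invariant. A complete flag $\mathcal T$ is a chain $\emptyset\subset T_1\subset T_2\subset\cdots\subset T_{n-1}=[n-1]$ with $|T_i|=i$. Put $$s_{\mathcal T}=\mathrm{lcm}\bigl(\mathbf x^{T_1\to[n]\setminus T_1},\dots,\mathbf x^{T_{n-1}\to[n]\setminus T_{n-1}}\bigr)/(x_1\cdots x_{n-1}),$$ and let $\phi(\mathcal T)$ be the reverse flag $T_{n-1}\setminus T_{n-2}\subset T_{n-1}\setminus T_{n-3}\subset\cdots\subset T_{n-1}\setminus T_1\subset T_{n-1}$. **Theorem.** 1. For every (graded) reverse lexicographic term order on $\mathbb K[x_1,\dots,x_n]$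 with $x_n$ as smallest variable, the initial ideal of $I_G$ is the ideal of $\mathbb K[x_1,\dots,x_n]$ generated by $M_G$. 2. $M_G$ is a Riemann–Roch monomial ideal, with canonical monomial $\mathbf x^{\mathbf K}=\prod_{i=1}^{n-1}x_i^{d_i+u_{in}-2}$ and genus $e-n+2$ (in particular, $\mathrm{MonSoc}(M_G)\neq\emptyset$). 3. $\mathcal T\mapsto s_{\mathcal T}$ is a bijection from the set of complete flags of subsets of $[n-1]$ onto $\mathrm{MonSoc}(M_G)$, and $s_{\phi(\mathcal T)}=\mathbf x^{\mathbf K}/s_{\mathcal T}$ for every complete flag $\mathcal T$. -/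

import Mathlib

open MvPolynomial

noncomputable section

namespace MonomialRR

/-! ### Monomial ideals and their Riemann-Roch notions -/

section MonomialIdeals

variable {𝕜 : Type*} [Field 𝕜] {m : ℕ}

/-- `M` is generated by monomials. -/
def IsMonomialIdeal (M : Ideal (MvPolynomial (Fin m) 𝕜)) : Prop :=
  ∃ S : Set (Fin m →₀ ℕ), M = Ideal.span ((fun a => monomial a (1 : 𝕜)) '' S)

/-- The exponents of the socle monomials of `𝕜[x] / M`: the monomials outside `M` all of whose
products with a variable lie in `M`. -/
def monSoc (M : Ideal (MvPolynomial (Fin m) 𝕜)) : Set (Fin m →₀ ℕ) :=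
  {c | monomial c (1 : 𝕜) ∉ M ∧ ∀ i, monomial (c + Finsupp.single i 1) (1 : 𝕜) ∈ M}

/-- `M` is artinian: the quotient ring `𝕜[x] / M` is artinian. -/
def IsArtinianIdeal (M : Ideal (MvPolynomial (Fin m) 𝕜)) : Prop :=
  IsArtinianRing (MvPolynomial (Fin m) 𝕜 ⧸ M)

/-- `M` is level: all socle monomials have the same degree. -/
def IsLevel (M : Ideal (MvPolynomial (Fin m) 𝕜)) : Prop :=
  ∀ c ∈ monSoc M, ∀ c' ∈ monSoc M, c.degree = c'.degree

/-- `g` is the genus of `M`: there is a socle monomial, and `g` is one plus the degree of each. -/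
def HasGenus (M : Ideal (MvPolynomial (Fin m) 𝕜)) (g : ℤ) : Prop :=
  (monSoc M).Nonempty ∧ ∀ c ∈ monSoc M, g = (c.degree : ℤ) + 1

/-- `x^K` is a canonical monomial of `M`: every socle monomial divides `x^K`, and
`x^c ↦ x^K / x^c` maps the set of socle monomials to itself
(as `K - (K - c) = c` for `c ≤ K`, this map is an involution of that set). -/
def IsCanonicalMonomial (M : Ideal (MvPolynomial (Fin m) 𝕜)) (K : Fin m →₀ ℕ) : Prop :=
  (∀ c ∈ monSoc M, c ≤ K) ∧ Set.MapsTo (fun c => K - c) (monSoc M) (monSoc M)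

/-- `M` has a canonical monomial. -/
def IsReflectionInvariant (M : Ideal (MvPolynomial (Fin m) 𝕜)) : Prop :=
  ∃ K : Fin m →₀ ℕ, IsCanonicalMonomial M K

/-- Riemann-Roch monomial ideals. -/
structure IsRiemannRoch (M : Ideal (MvPolynomial (Fin m) 𝕜)) : Prop where
  isMonomialIdeal : IsMonomialIdeal M
  isArtinian : IsArtinianIdeal M
  isLevel : IsLevel M
  isReflectionInvariant : IsReflectionInvariant M

end MonomialIdeals

/-! ### Reverse lexicographic initial ideals -/

section InitialIdeals

variable {n : ℕ}

/-- The (graded) reverse lexicographic order on exponent vectors. The permutation `τ` gives the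
position of each variable, from the largest variable (position `0`) to the smallest one
(position `n - 1`). One has `a < b` if the degree of `a` is smaller, or if the degrees agree and,
at the smallest variable in which `a` and `b` differ, the exponent in `a` is larger. -/
def RevLexLT (τ : Equiv.Perm (Fin n)) (a b : Fin n →₀ ℕ) : Prop :=
  a.degree < b.degree ∨
    (a.degree = b.degree ∧ ∃ i, b i < a i ∧ ∀ j, τ i < τ j → a j = b j)

/-- `a` is the exponent of the leading monomial of `f` for the order `lt`. -/
def IsLeadingExponent {𝕜 : Type*} [Field 𝕜] (lt : (Fin n →₀ ℕ) → (Fin n →₀ ℕ) → Prop)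
    (f : MvPolynomial (Fin n) 𝕜) (a : Fin n →₀ ℕ) : Prop :=
  a ∈ f.support ∧ ∀ b ∈ f.support, b ≠ a → lt b a

/-- The ideal generated by the leading monomials of the elements of `I`. -/
def initialIdeal {𝕜 : Type*} [Field 𝕜] (lt : (Fin n →₀ ℕ) → (Fin n →₀ ℕ) → Prop)
    (I : Ideal (MvPolynomial (Fin n) 𝕜)) : Ideal (MvPolynomial (Fin n) 𝕜) :=
  Ideal.span {p | ∃ f ∈ I, ∃ a, IsLeadingExponent lt f a ∧ p = monomial a (1 : 𝕜)}

end InitialIdeals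

/-! ### Graphs -/

/-- Undirected graphs on `n` labelled nodes, with multiple edges but without loops:
`mult i j` is the number of edges between the nodes `i` and `j`. -/
structure Multigraph (n : ℕ) where
  mult : Fin n → Fin n → ℕ
  symm : ∀ i j, mult i j = mult j i
  loopless : ∀ i, mult i i = 0

namespace Multigraph

/-- Any two distinct nodes are joined by at least one edge. -/
def IsSaturated {n : ℕ} (G : Multigraph n) : Prop :=
  ∀ i j, i ≠ j → 0 < G.mult i j

/-- The degree of a node. -/
def degree {n : ℕ} (G : Multigraph n) (i : Fin n) : ℕ :=
  ∑ j, G.mult i j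

/-- The number of edges. -/
def numEdges {n : ℕ} (G : Multigraph n) : ℕ :=
  ∑ i, ∑ j ∈ Finset.Ioi i, G.mult i j

/-- The Laplacian matrix. -/
def laplacian {n : ℕ} (G : Multigraph n) : Matrix (Fin n) (Fin n) ℤ :=
  Matrix.of fun i j => if i = j then (G.degree i : ℤ) else -(G.mult i j : ℤ)

/-- The lattice spanned by the columns of the Laplacian. -/
def laplacianLattice {n : ℕ} (G : Multigraph n) : Submodule ℤ (Fin n → ℤ) :=
  LinearMap.range G.laplacian.mulVecLin

/-- The toppling ideal `I_G`, generated by the binomials `x^u - x^v` with `u - v` in the lattice. -/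
def topplingIdeal (𝕜 : Type*) [Field 𝕜] {n : ℕ} (G : Multigraph n) :
    Ideal (MvPolynomial (Fin n) 𝕜) :=
  Ideal.span {p | ∃ u v : Fin n →₀ ℕ,
    (fun i => (u i : ℤ) - (v i : ℤ)) ∈ G.laplacianLattice ∧
      p = monomial u (1 : 𝕜) - monomial v 1}

/-! From now on there are `n = m + 1` nodes; the last node `Fin.last m` is the distinguished one,
and the nodes `i.castSucc` with `i : Fin m` are the others. -/

variable {m : ℕ}

/-- The exponent of `x^{I → [n] \ I} = ∏_{i ∈ I} x_i ^ (∑_{k ∉ I} u_{ik})`, for a set `I` of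
nodes that does not contain the last one. Here `k` runs through all nodes outside `I`, the last
one included. -/
def cutExponent (G : Multigraph (m + 1)) (I : Finset (Fin m)) : Fin m →₀ ℕ :=
  Finsupp.equivFunOnFinite.symm fun i =>
    if i ∈ I then ∑ k ∈ (I.map Fin.castSuccEmb)ᶜ, G.mult i.castSucc k else 0

/-- The parking function ideal `M_G`, an ideal of the polynomial ring in the variables of all nodes
but the last. -/
def parkingIdeal (𝕜 : Type*) [Field 𝕜] (G : Multigraph (m + 1)) :
    Ideal (MvPolynomial (Fin m) 𝕜) :=
  Ideal.span {p | ∃ I : Finset (Fin m), I.Nonempty ∧ p = monomial (G.cutExponent I) (1 : 𝕜)}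

/-- The exponent vector `d_i + u_{in} - 2`. -/
def canonicalExponent (G : Multigraph (m + 1)) : Fin m →₀ ℕ :=
  Finsupp.equivFunOnFinite.symm fun i =>
    G.degree i.castSucc + G.mult i.castSucc (Fin.last m) - 2

/-- For a saturated graph the subtraction in `canonicalExponent` does not truncate. -/
theorem canonicalExponent_add_two (G : Multigraph (m + 1)) (hG : G.IsSaturated) (i : Fin m) :
    G.canonicalExponent i + 2 = G.degree i.castSucc + G.mult i.castSucc (Fin.last m) := by
  have h1 : 0 < G.mult i.castSucc (Fin.last m) := hG _ _ (Fin.castSucc_lt_last i).ne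
  have h2 : G.mult i.castSucc (Fin.last m) ≤ G.degree i.castSucc :=
    Finset.single_le_sum (f := fun j => G.mult i.castSucc j) (fun _ _ => Nat.zero_le _)
      (Finset.mem_univ _)
  simp only [canonicalExponent, Finsupp.equivFunOnFinite_symm_apply_apply]
  omega

end Multigraph

/-! ### Complete flags -/

/-- A complete flag `∅ = T_0 ⊂ T_1 ⊂ ⋯ ⊂ T_m` of subsets of an `m`-element set, where `T_i` has
`i` elements (so that each step adds a single element, and `T_m` is the whole set). -/
@[ext]
structure CompleteFlag (m : ℕ) where
  set : Fin (m + 1) → Finset (Fin m)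
  monotone : Monotone set
  card_set : ∀ i, (set i).card = i

/-- The reverse flag, whose `i`-th set is the complement `T_m \ T_{m - i}`. -/
def CompleteFlag.reverse {m : ℕ} (T : CompleteFlag m) : CompleteFlag m where
  set i := (T.set i.rev)ᶜ
  monotone i j h := by
    have := T.monotone (Fin.rev_le_rev.mpr h)
    exact Finset.compl_subset_compl.mpr this
  card_set i := by
    rw [Finset.card_compl, T.card_set, Fintype.card_fin, Fin.val_rev]
    omega

/-- The exponent of the monomial
`s_T = lcm (x^{T_1 → [n] \ T_1}, …, x^{T_{n-1} → [n] \ T_{n-1}}) / (x_1 ⋯ x_{n-1})`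
(the extra set `T_0 = ∅` contributes the monomial `1` to the least common multiple). -/
def Multigraph.flagExponent {m : ℕ} (G : Multigraph (m + 1)) (T : CompleteFlag m) :
    Fin m →₀ ℕ :=
  Finsupp.equivFunOnFinite.symm fun j =>
    (Finset.univ.sup fun i => G.cutExponent (T.set i) j) - 1

/-- For a saturated graph the subtraction in `flagExponent` does not truncate. -/
theorem Multigraph.flagExponent_add_one {m : ℕ} (G : Multigraph (m + 1)) (hG : G.IsSaturated)
    (T : CompleteFlag m) (j : Fin m) :
    G.flagExponent T j + 1 = Finset.univ.sup fun i => G.cutExponent (T.set i) j := by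
  have hT : T.set (Fin.last m) = Finset.univ := by
    rw [← Finset.card_eq_iff_eq_univ, T.card_set, Fintype.card_fin, Fin.val_last]
  have h1 : 0 < G.mult j.castSucc (Fin.last m) := hG _ _ (Fin.castSucc_lt_last j).ne
  have h2 : G.cutExponent (T.set (Fin.last m)) j ≤
      Finset.univ.sup fun i => G.cutExponent (T.set i) j :=
    Finset.le_sup (f := fun i => G.cutExponent (T.set i) j) (Finset.mem_univ _)
  have h3 : G.mult j.castSucc (Fin.last m) ≤ G.cutExponent (T.set (Fin.last m)) j := by
    simp only [cutExponent, hT, Finsupp.equivFunOnFinite_symm_apply_apply, Finset.mem_univ,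
      if_true]
    refine Finset.single_le_sum (f := fun k => G.mult j.castSucc k)
      (fun _ _ => Nat.zero_le _) ?_
    simp [Fin.ext_iff]
    intro a; exact a.isLt.ne
  simp only [flagExponent, Finsupp.equivFunOnFinite_symm_apply_apply]
  omega

end MonomialRR

end

open MvPolynomial

namespace MonomialRR

/-! ### Sums over ordered pairs -/

/-! A complete flag is a permutation `p` recording the position at which each node enters. Cut
exponents decrease as the set grows, so the least common multiple is attained at `j` by the first
set of the flag containing `j`. Hence `s_T` at `j`, plus one, counts the edges from `j` to the last
node and to the nodes in later positions (`flagExponent_ofPerm_eq_sum`). Summing over `j` counts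
every edge once, which gives the degree. Reversing the flag exchanges later and earlier nodes, which
gives the canonical monomial.

The monomials outside `M_G` are the parking functions. Each `s_T` is one, and raising any coordinate
of it violates the condition on an initial segment of the order. Conversely, Dhar's burning
algorithm orders the nodes so that a given parking function lies below the corresponding `s_T`
(`IsParking.exists_le_flagExponent`). So the `s_T` are exactly the socle monomials. Distinct orders
give distinct `s_T`, because saturation makes the edge counts strictly monotone.

For the initial ideal, grade by exponents modulo the Laplacian lattice: the coefficients of an
element of `I_G` sum to zero over each class. By a maximum principle for the Laplacian, an exponent
with parking restriction has a strictly larger last coordinate than every other exponent in its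
class (`last_lt_last_of_isParking`), so it is the smallest of them in reverse lexicographic order.
As a leading exponent it would be alone in its class, which is impossible. Conversely, each
generator of `M_G` leads the binomial obtained by firing its set of nodes, since the other term
involves the last variable. -/

theorem two_mul_sum_sum_filter_lt {n : ℕ} (w : Fin n → Fin n → ℕ) (hw : ∀ i j, w i j = w j i)
    (hw0 : ∀ i, w i i = 0) (p : Equiv.Perm (Fin n)) :
    2 * ∑ i, ∑ j with p i < p j, w i j = ∑ i, ∑ j, w i j := by
  have h : ∑ i, ∑ j with p i < p j, w i j = ∑ i, ∑ j with p j < p i, w i j := by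
    simp only [Finset.sum_filter]
    rw [Finset.sum_comm]
    simp only [hw]
  rw [two_mul]
  nth_rw 2 [h]
  rw [← Finset.sum_add_distrib]
  refine Finset.sum_congr rfl fun i _ => ?_
  rw [Finset.sum_filter, Finset.sum_filter, ← Finset.sum_add_distrib]
  refine Finset.sum_congr rfl fun j _ => ?_
  rcases lt_trichotomy (p i) (p j) with h | h | h
  · simp [h, h.not_gt]
  · obtain rfl := p.injective h
    simp [hw0]
  · simp [h, h.not_gt]

/-! ### Complete flags and permutations -/

/-- The flag whose `i`-th set consists of the elements in the first `i` positions. -/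
def CompleteFlag.ofPerm {m : ℕ} (p : Equiv.Perm (Fin m)) : CompleteFlag m where
  set i := {j | (p j).castSucc < i}
  monotone i i' h j hj := by
    simp only [Finset.mem_filter, Finset.mem_univ, true_and] at hj ⊢
    exact hj.trans_le h
  card_set i := by
    have h : (Finset.univ.filter fun j => (p j).castSucc < i).map p.toEmbedding =
        Finset.univ.filter fun j : Fin m => j.castSucc < i := by
      ext j
      simp [Finset.mem_map_equiv]
    rw [← Finset.card_map p.toEmbedding, h]
    have h' : (Finset.univ.filter fun j : Fin m => j.castSucc < i).map Fin.valEmbedding =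
        Finset.range i := by
      ext k
      simp only [Finset.mem_map, Finset.mem_filter, Finset.mem_univ, true_and,
        Fin.valEmbedding_apply, Finset.mem_range, Fin.lt_def, Fin.val_castSucc]
      constructor
      · rintro ⟨j, hj, rfl⟩
        exact hj
      · intro hk
        exact ⟨⟨k, by omega⟩, hk, rfl⟩
    rw [← Finset.card_map Fin.valEmbedding, h', Finset.card_range]

theorem CompleteFlag.mem_ofPerm {m : ℕ} (p : Equiv.Perm (Fin m)) (i : Fin (m + 1)) (j : Fin m) :
    j ∈ (ofPerm p).set i ↔ (p j).castSucc < i := by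
  simp [ofPerm]

/-- The position of `j` is the step at which it enters the flag. Each step adds only one element, so
positions are distinct. -/
theorem CompleteFlag.exists_ofPerm {m : ℕ} (T : CompleteFlag m) :
    ∃ p : Equiv.Perm (Fin m), ofPerm p = T := by
  have h0 : T.set 0 = ∅ := by rw [← Finset.card_eq_zero, T.card_set, Fin.val_zero]
  have hl : T.set (Fin.last m) = Finset.univ := by
    rw [← Finset.card_eq_iff_eq_univ, T.card_set, Fintype.card_fin, Fin.val_last]
  have key : ∀ j : Fin m, ∃ i : Fin m, j ∉ T.set i.castSucc ∧ j ∈ T.set i.succ := by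
    intro j
    by_contra! h
    have : ∀ i, j ∉ T.set i := by
      intro i
      induction i using Fin.induction with
      | zero => simp [h0]
      | succ i ih => exact h i ih
    exact this (Fin.last m) (by simp [hl])
  choose p hp1 hp2 using key
  have hinj : Function.Injective p := by
    intro j k hjk
    have hc : (T.set (p j).succ \ T.set (p j).castSucc).card = 1 := by
      rw [Finset.card_sdiff_of_subset (T.monotone (Fin.castSucc_lt_succ).le), T.card_set,
        T.card_set]
      simp
    refine Finset.card_le_one.mp hc.le j ?_ k ?_
    · exact Finset.mem_sdiff.mpr ⟨hp2 j, hp1 j⟩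
    · rw [hjk]
      exact Finset.mem_sdiff.mpr ⟨hp2 k, hp1 k⟩
  refine ⟨Equiv.ofBijective p (Finite.injective_iff_bijective.mp hinj), ?_⟩
  ext i j
  rw [mem_ofPerm, Equiv.ofBijective_apply]
  constructor
  · intro h
    exact T.monotone (by simpa [Fin.le_def, Fin.lt_def, Nat.succ_le_iff] using h) (hp2 j)
  · intro h
    by_contra! h'
    exact hp1 j (T.monotone h' h)

theorem CompleteFlag.reverse_ofPerm {m : ℕ} (p : Equiv.Perm (Fin m)) :
    (ofPerm p).reverse = ofPerm (p.trans Fin.revPerm) := by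
  ext i j
  have : j ∈ (ofPerm p).reverse.set i ↔ j ∉ (ofPerm p).set i.rev := by
    simp [CompleteFlag.reverse]
  rw [this, mem_ofPerm, mem_ofPerm]
  simp only [Fin.lt_def, Fin.val_castSucc, Fin.val_rev, Equiv.trans_apply, Fin.revPerm_apply]
  omega

namespace Multigraph

variable {m : ℕ} (G : Multigraph (m + 1))

/-! ### Cut exponents and flag exponents -/

theorem cutExponent_of_notMem {I : Finset (Fin m)} {j : Fin m} (hj : j ∉ I) :
    G.cutExponent I j = 0 := by
  simp [cutExponent, hj]

theorem sum_compl_map_castSucc {M : Type*} [AddCommMonoid M] (I : Finset (Fin m))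
    (f : Fin (m + 1) → M) :
    ∑ k ∈ (I.map Fin.castSuccEmb)ᶜ, f k = (∑ k ∈ Iᶜ, f k.castSucc) + f (Fin.last m) := by
  have h : (I.map Fin.castSuccEmb)ᶜ = Finset.univ.filter (· ∉ I.map Fin.castSuccEmb) := by
    ext; simp
  have h' : Iᶜ = Finset.univ.filter (· ∉ I) := by ext; simp
  rw [h, h', Finset.sum_filter, Finset.sum_filter, Fin.sum_univ_castSucc]
  congr 1
  · refine Finset.sum_congr rfl fun k _ => ?_
    simp
  · rw [if_pos]
    simp only [Finset.mem_map, not_exists, not_and]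
    intro k _ hk
    exact (Fin.castSucc_lt_last k).ne hk

theorem cutExponent_of_mem {I : Finset (Fin m)} {j : Fin m} (hj : j ∈ I) :
    G.cutExponent I j =
      (∑ k ∈ Iᶜ, G.mult j.castSucc k.castSucc) + G.mult j.castSucc (Fin.last m) := by
  rw [← sum_compl_map_castSucc I (G.mult j.castSucc)]
  simp [cutExponent, hj]

theorem cutExponent_anti {I J : Finset (Fin m)} (h : I ⊆ J) {j : Fin m} (hj : j ∈ I) :
    G.cutExponent J j ≤ G.cutExponent I j := by
  rw [G.cutExponent_of_mem hj, G.cutExponent_of_mem (h hj)]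
  gcongr

/-- The elements up to the position of `j`. -/
def initialSet (p : Equiv.Perm (Fin m)) (j : Fin m) : Finset (Fin m) := {k | p k ≤ p j}

theorem mem_initialSet {p : Equiv.Perm (Fin m)} {j k : Fin m} :
    k ∈ initialSet p j ↔ p k ≤ p j := by
  simp [initialSet]

theorem compl_initialSet (p : Equiv.Perm (Fin m)) (j : Fin m) :
    (initialSet p j)ᶜ = Finset.univ.filter fun k => p j < p k := by
  ext; simp [mem_initialSet]

variable {G}

/-- Sets of the flag missing `j` contribute zero, and among those containing `j` the smallest,
`initialSet p j`, has the largest cut exponent. -/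
theorem flagExponent_ofPerm (hG : G.IsSaturated) (p : Equiv.Perm (Fin m)) (j : Fin m) :
    G.flagExponent (CompleteFlag.ofPerm p) j + 1 = G.cutExponent (initialSet p j) j := by
  rw [flagExponent_add_one G hG]
  have hset : (CompleteFlag.ofPerm p).set (p j).succ = initialSet p j := by
    ext k
    rw [CompleteFlag.mem_ofPerm, mem_initialSet, Fin.castSucc_lt_succ_iff]
  apply le_antisymm
  · refine Finset.sup_le fun i _ => ?_
    by_cases hj : j ∈ (CompleteFlag.ofPerm p).set i
    · refine G.cutExponent_anti (fun k hk => ?_) (mem_initialSet.mpr le_rfl)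
      rw [mem_initialSet] at hk
      rw [CompleteFlag.mem_ofPerm] at hj ⊢
      exact (Fin.castSucc_le_castSucc_iff.mpr hk).trans_lt hj
    · rw [G.cutExponent_of_notMem hj]
      exact Nat.zero_le _
  · rw [← hset]
    exact Finset.le_sup (f := fun i => G.cutExponent ((CompleteFlag.ofPerm p).set i) j)
      (Finset.mem_univ _)

theorem flagExponent_ofPerm_eq_sum (hG : G.IsSaturated) (p : Equiv.Perm (Fin m)) (j : Fin m) :
    G.flagExponent (CompleteFlag.ofPerm p) j + 1 =
      (∑ k with p j < p k, G.mult j.castSucc k.castSucc) + G.mult j.castSucc (Fin.last m) := by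
  rw [flagExponent_ofPerm hG, G.cutExponent_of_mem (mem_initialSet.mpr le_rfl), compl_initialSet]

/-- Every edge from `j` to another non-last node is counted by exactly one of the two orders, while
an edge to the last node is counted by both. The two subtracted ones account for the `- 2`. -/
theorem flagExponent_reverse_add (hG : G.IsSaturated) (T : CompleteFlag m) :
    G.flagExponent T.reverse + G.flagExponent T = G.canonicalExponent := by
  obtain ⟨p, rfl⟩ := T.exists_ofPerm
  rw [CompleteFlag.reverse_ofPerm]
  ext j
  rw [Finsupp.add_apply]
  have h1 := flagExponent_ofPerm_eq_sum hG p j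
  have h2 := flagExponent_ofPerm_eq_sum hG (p.trans Fin.revPerm) j
  have h3 := canonicalExponent_add_two G hG j
  simp only [Equiv.trans_apply, Fin.revPerm_apply, Fin.rev_lt_rev] at h2
  have h4 : G.degree j.castSucc = (∑ k with p j < p k, G.mult j.castSucc k.castSucc) +
      (∑ k with p k < p j, G.mult j.castSucc k.castSucc) + G.mult j.castSucc (Fin.last m) := by
    rw [degree, Fin.sum_univ_castSucc, Finset.sum_filter, Finset.sum_filter,
      ← Finset.sum_add_distrib]
    congr 1
    refine Finset.sum_congr rfl fun k _ => ?_
    rcases lt_trichotomy (p j) (p k) with h | h | h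
    · simp [h, h.not_gt]
    · obtain rfl := p.injective h
      simp [G.loopless]
    · simp [h, h.not_gt]
  omega

/-- Orienting each edge from the earlier to the later endpoint, with the last node at the end,
counts it once. The `m` compensates for the division by the product of the variables. -/
theorem degree_flagExponent_add (hG : G.IsSaturated) (T : CompleteFlag m) :
    (G.flagExponent T).degree + m = G.numEdges := by
  obtain ⟨p, rfl⟩ := T.exists_ofPerm
  have h1 : (G.flagExponent (CompleteFlag.ofPerm p)).degree + m =
      ∑ j, (G.flagExponent (CompleteFlag.ofPerm p) j + 1) := by
    rw [Finset.sum_add_distrib, Finsupp.degree_eq_sum]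
    simp
  have h2 := two_mul_sum_sum_filter_lt G.mult G.symm G.loopless (Equiv.refl _)
  have h3 := two_mul_sum_sum_filter_lt (fun j k : Fin m => G.mult j.castSucc k.castSucc)
    (fun _ _ => G.symm _ _) (fun _ => G.loopless _) p
  have h4 : G.numEdges = ∑ i, ∑ j with Equiv.refl (Fin (m + 1)) i < Equiv.refl _ j,
      G.mult i j := by
    refine Finset.sum_congr rfl fun i _ => Finset.sum_congr ?_ fun _ _ => rfl
    ext j
    rw [Finset.mem_Ioi, Finset.mem_filter]
    simp
  have h5 : ∑ i, ∑ j, G.mult i j = (∑ j : Fin m, ∑ k : Fin m, G.mult j.castSucc k.castSucc) +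
      2 * ∑ j : Fin m, G.mult j.castSucc (Fin.last m) := by
    rw [Fin.sum_univ_castSucc]
    simp only [Fin.sum_univ_castSucc, G.loopless, Finset.sum_add_distrib,
      G.symm (Fin.last m)]
    ring
  rw [h1]
  simp only [flagExponent_ofPerm_eq_sum hG, Finset.sum_add_distrib]
  omega

/-! ### Parking functions and maximal parking functions -/

variable (G) in
/-- The exponents of the monomials outside the parking function ideal. -/
def IsParking (c : Fin m →₀ ℕ) : Prop :=
  ∀ I : Finset (Fin m), I.Nonempty → ∃ j ∈ I, c j < G.cutExponent I j

theorem not_isParking {c : Fin m →₀ ℕ} :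
    ¬ G.IsParking c ↔ ∃ I : Finset (Fin m), I.Nonempty ∧ G.cutExponent I ≤ c := by
  simp only [IsParking, not_forall, not_exists, not_and, not_lt, exists_prop]
  refine exists_congr fun I => and_congr_right fun _ => ⟨fun h j => ?_, fun h j _ => h j⟩
  by_cases hj : j ∈ I
  · exact h j hj
  · rw [G.cutExponent_of_notMem hj]
    exact Nat.zero_le _

theorem IsParking.mono {c c' : Fin m →₀ ℕ} (h : G.IsParking c) (hc : c' ≤ c) :
    G.IsParking c' := fun I hI =>
  (h I hI).imp fun j hj => ⟨hj.1, (hc j).trans_lt hj.2⟩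

variable (G) in
theorem parkingIdeal_eq_span_image (𝕜 : Type*) [Field 𝕜] :
    G.parkingIdeal 𝕜 = Ideal.span ((fun a => monomial a (1 : 𝕜)) ''
      (G.cutExponent '' {I : Finset (Fin m) | I.Nonempty})) := by
  rw [parkingIdeal]
  congr 1
  ext p
  simp [eq_comm]

theorem monomial_mem_parkingIdeal {𝕜 : Type*} [Field 𝕜] {c : Fin m →₀ ℕ} :
    monomial c (1 : 𝕜) ∈ G.parkingIdeal 𝕜 ↔ ¬ G.IsParking c := by
  rw [parkingIdeal_eq_span_image, mem_ideal_span_monomial_image, not_isParking]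
  simp

theorem mem_monSoc_parkingIdeal {𝕜 : Type*} [Field 𝕜] {c : Fin m →₀ ℕ} :
    c ∈ monSoc (G.parkingIdeal 𝕜) ↔
      G.IsParking c ∧ ∀ i, ¬ G.IsParking (c + Finsupp.single i 1) := by
  simp [monSoc, monomial_mem_parkingIdeal]

theorem isParking_flagExponent (hG : G.IsSaturated) (p : Equiv.Perm (Fin m)) :
    G.IsParking (G.flagExponent (CompleteFlag.ofPerm p)) := by
  intro I hI
  -- The element of `I` in the last position works: `I` is contained in its initial segment, so the
  -- cut at `j` only gets larger.
  obtain ⟨j, hj, hmax⟩ := I.exists_max_image p hI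
  refine ⟨j, hj, ?_⟩
  have h1 := flagExponent_ofPerm hG p j
  have h2 := G.cutExponent_anti (fun k hk => mem_initialSet.mpr (hmax k hk)) hj
  omega

theorem not_isParking_flagExponent_add (hG : G.IsSaturated) (p : Equiv.Perm (Fin m))
    (i : Fin m) :
    ¬ G.IsParking (G.flagExponent (CompleteFlag.ofPerm p) + Finsupp.single i 1) := by
  intro h
  -- The initial segment ending at `i` violates the parking condition: at `i` the exponent now
  -- equals the cut, and for an earlier `j` the segment of `j` leaves out `i`, so by saturation its
  -- cut exceeds this one by at least one.
  obtain ⟨j, hj, hlt⟩ := h (initialSet p i) ⟨i, mem_initialSet.mpr le_rfl⟩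
  have h1 := flagExponent_ofPerm hG p j
  rw [Finsupp.add_apply] at hlt
  rcases eq_or_ne j i with rfl | hne
  · rw [Finsupp.single_eq_same] at hlt
    omega
  · rw [Finsupp.single_eq_of_ne hne] at hlt
    have hji : p j < p i :=
      lt_of_le_of_ne (mem_initialSet.mp hj) fun h => hne (p.injective h)
    rw [G.cutExponent_of_mem hj] at hlt
    rw [G.cutExponent_of_mem (mem_initialSet.mpr le_rfl)] at h1
    have h2 : ∑ k ∈ (initialSet p i)ᶜ, G.mult j.castSucc k.castSucc <
        ∑ k ∈ (initialSet p j)ᶜ, G.mult j.castSucc k.castSucc := by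
      refine Finset.sum_lt_sum_of_subset (i := i) ?_ ?_ ?_ ?_ fun _ _ _ => Nat.zero_le _
      · intro k hk
        rw [compl_initialSet, Finset.mem_filter] at hk ⊢
        exact ⟨hk.1, hji.trans hk.2⟩
      · simp [mem_initialSet, hji]
      · simp [mem_initialSet]
      · exact hG _ _ fun h => hne (Fin.castSucc_injective m h)
    omega

/-- The burning algorithm of Dhar, run on the set `A`. -/
theorem IsParking.exists_burning_order {c : Fin m →₀ ℕ} (hc : G.IsParking c)
    (A : Finset (Fin m)) :
    ∃ p : Fin m → ℕ, Set.InjOn p A ∧ (∀ j ∈ A, p j < A.card) ∧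
      ∀ j ∈ A, c j < G.cutExponent (A.filter fun k => p k ≤ p j) j := by
  induction A using Finset.strongInduction with
  | H A ih =>
    rcases A.eq_empty_or_nonempty with rfl | hA
    · exact ⟨0, by simp, by simp, by simp⟩
    -- The parking condition on `A` itself supplies a node that burns first. It gets the last
    -- position, and the rest is ordered by induction.
    obtain ⟨i, hi, hlt⟩ := hc A hA
    obtain ⟨p, hinj, hcard, hp⟩ := ih (A.erase i) (Finset.erase_ssubset hi)
    have hc1 : (A.erase i).card + 1 = A.card := Finset.card_erase_add_one hi
    have hlt' : ∀ j ∈ A, j ≠ i → p j < (A.erase i).card := fun j hj hji =>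
      hcard j (Finset.mem_erase.mpr ⟨hji, hj⟩)
    refine ⟨Function.update p i (A.erase i).card, ?_, ?_, ?_⟩
    · intro j hj k hk hjk
      by_cases hji : j = i <;> by_cases hki : k = i
      · rw [hji, hki]
      · subst hji
        rw [Function.update_self, Function.update_of_ne hki] at hjk
        exact absurd (hlt' k hk hki) (by omega)
      · subst hki
        rw [Function.update_self, Function.update_of_ne hji] at hjk
        exact absurd (hlt' j hj hji) (by omega)
      · rw [Function.update_of_ne hji, Function.update_of_ne hki] at hjk
        exact hinj (by simpa using ⟨hj, hji⟩) (by simpa using ⟨hk, hki⟩) hjk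
    · intro j hj
      by_cases hji : j = i
      · subst hji
        rw [Function.update_self]
        omega
      · rw [Function.update_of_ne hji]
        have := hlt' j hj hji
        omega
    · intro j hj
      by_cases hji : j = i
      · subst hji
        convert hlt using 2
        refine congrArg _ (Finset.filter_true_of_mem fun k hk => ?_)
        rw [Function.update_self]
        by_cases hkj : k = j
        · rw [hkj, Function.update_self]
        · rw [Function.update_of_ne hkj]
          exact (hlt' k hk hkj).le
      · have h := hp j (Finset.mem_erase.mpr ⟨hji, hj⟩)
        convert h using 2
        refine congrArg _ ?_
        ext k
        simp only [Finset.mem_filter, Finset.mem_erase, Function.update_of_ne hji]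
        by_cases hki : k = i
        · subst hki
          have := hlt' j hj hji
          simp only [Function.update_self, ne_eq, not_true_eq_false, false_and, iff_false,
            not_and, not_le]
          exact fun _ => this
        · simp [hki]

theorem IsParking.exists_le_flagExponent (hG : G.IsSaturated) {c : Fin m →₀ ℕ}
    (hc : G.IsParking c) :
    ∃ p : Equiv.Perm (Fin m), c ≤ G.flagExponent (CompleteFlag.ofPerm p) := by
  obtain ⟨p, hinj, hcard, hp⟩ := hc.exists_burning_order Finset.univ
  have hcard' : ∀ j, p j < m := fun j => by simpa using hcard j (Finset.mem_univ j)
  have hinj' : Function.Injective fun j => (⟨p j, hcard' j⟩ : Fin m) := fun j k h =>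
    hinj (Finset.mem_coe.mpr (Finset.mem_univ j)) (Finset.mem_coe.mpr (Finset.mem_univ k))
      (Fin.mk.inj_iff.mp h)
  refine ⟨Equiv.ofBijective _ (Finite.injective_iff_bijective.mp hinj'), fun j => ?_⟩
  have h := hp j (Finset.mem_univ j)
  have h' := flagExponent_ofPerm hG
    (Equiv.ofBijective _ (Finite.injective_iff_bijective.mp hinj')) j
  have hs : initialSet (Equiv.ofBijective _ (Finite.injective_iff_bijective.mp hinj')) j =
      Finset.univ.filter fun k => p k ≤ p j := by
    ext k
    simp [mem_initialSet]
  rw [hs] at h'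
  omega

theorem flagExponent_mem_monSoc (𝕜 : Type*) [Field 𝕜] (hG : G.IsSaturated)
    (T : CompleteFlag m) : G.flagExponent T ∈ monSoc (G.parkingIdeal 𝕜) := by
  obtain ⟨p, rfl⟩ := T.exists_ofPerm
  exact mem_monSoc_parkingIdeal.mpr
    ⟨isParking_flagExponent hG p, not_isParking_flagExponent_add hG p⟩

theorem exists_flagExponent_eq {𝕜 : Type*} [Field 𝕜] (hG : G.IsSaturated) {c : Fin m →₀ ℕ}
    (hc : c ∈ monSoc (G.parkingIdeal 𝕜)) : ∃ T : CompleteFlag m, G.flagExponent T = c := by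
  rw [mem_monSoc_parkingIdeal] at hc
  obtain ⟨p, hp⟩ := hc.1.exists_le_flagExponent hG
  refine ⟨_, (le_antisymm hp fun i => ?_).symm⟩
  by_contra! hlt
  -- If `c` were strictly below `s_T` at `i`, raising it there would keep it below `s_T`, hence
  -- parking.
  refine hc.2 i ((isParking_flagExponent hG p).mono fun j => ?_)
  rw [Finsupp.add_apply]
  rcases eq_or_ne j i with rfl | hne
  · rw [Finsupp.single_eq_same]
    omega
  · rw [Finsupp.single_eq_of_ne hne]
    exact hp j

theorem flagExponent_injective (hG : G.IsSaturated) : Function.Injective G.flagExponent := by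
  intro T T' hTT
  obtain ⟨p, rfl⟩ := T.exists_ofPerm
  obtain ⟨q, rfl⟩ := T'.exists_ofPerm
  by_contra hne
  have hpq : (Finset.univ.filter fun j => p j ≠ q j).Nonempty := by
    by_contra h
    rw [Finset.not_nonempty_iff_eq_empty, Finset.filter_eq_empty_iff] at h
    exact hne (congrArg _ (Equiv.ext fun j => not_not.mp (h (Finset.mem_univ j))))
  -- Take the node of disagreement that is last for `p`. All later positions agree, so `q` places
  -- `j` strictly earlier. The node that `q` puts at position `p j` then follows `j` for `q` but not
  -- for `p`, which by saturation makes the two exponents differ at `j`.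
  obtain ⟨j, hj, hmax⟩ := Finset.exists_max_image _ p hpq
  have hj' : p j ≠ q j := by simpa using hj
  have hagree : ∀ k, p j < p k → p k = q k := by
    intro k hk
    by_contra h
    exact absurd (hmax k (by simpa using h)) (not_le.mpr hk)
  have hlt : q j < p j := by
    by_contra! h
    have h1 := hagree (p.symm (q j)) (by simpa using lt_of_le_of_ne h hj')
    rw [Equiv.apply_symm_apply] at h1
    have h2 := q.injective h1
    rw [Equiv.eq_symm_apply] at h2
    exact hj' h2
  have hk0 : q (q.symm (p j)) = p j := q.apply_symm_apply _
  have hsum : ∑ k with p j < p k, G.mult j.castSucc k.castSucc <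
      ∑ k with q j < q k, G.mult j.castSucc k.castSucc := by
    refine Finset.sum_lt_sum_of_subset (i := q.symm (p j)) ?_ ?_ ?_ ?_ fun _ _ _ => Nat.zero_le _
    · intro k hk
      rw [Finset.mem_filter] at hk ⊢
      exact ⟨hk.1, hagree k hk.2 ▸ hlt.trans hk.2⟩
    · simpa using hlt
    · simp only [Finset.mem_filter, Finset.mem_univ, true_and]
      intro h
      have := hagree _ h
      rw [hk0] at this
      exact h.ne' this
    · refine hG _ _ fun h => ?_
      rw [← Fin.castSucc_injective m h] at hk0
      exact hlt.ne hk0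
  have h1 := flagExponent_ofPerm_eq_sum hG p j
  have h2 := flagExponent_ofPerm_eq_sum hG q j
  rw [hTT] at h1
  omega

/-! ### The Riemann-Roch property -/

-- Singleton cuts put a power of every variable in the ideal, so the quotient is generated by
-- finitely many integral elements and is finite-dimensional.
variable (G) in
theorem isArtinianIdeal_parkingIdeal (𝕜 : Type*) [Field 𝕜] :
    IsArtinianIdeal (G.parkingIdeal 𝕜) := by
  have hint : ∀ i : Fin m, IsIntegral 𝕜 (Ideal.Quotient.mk (G.parkingIdeal 𝕜) (X i)) := by
    intro i
    -- The `+ 1` keeps the power positive, as the cut may be zero without saturation.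
    refine IsIntegral.of_pow (n := G.cutExponent {i} i + 1) (Nat.succ_pos _) ?_
    rw [← map_pow, Ideal.Quotient.eq_zero_iff_mem.mpr]
    · exact isIntegral_zero
    rw [X_pow_eq_monomial, monomial_mem_parkingIdeal, not_isParking]
    refine ⟨{i}, Finset.singleton_nonempty i, fun j => ?_⟩
    by_cases hj : j = i
    · subst hj
      simp
    · rw [G.cutExponent_of_notMem (by simpa using hj)]
      exact Nat.zero_le _
  have hadj : Algebra.adjoin 𝕜
      (Set.range fun i : Fin m => Ideal.Quotient.mk (G.parkingIdeal 𝕜) (X i)) = ⊤ := by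
    have h := congrArg (Subalgebra.map (Ideal.Quotient.mkₐ 𝕜 (G.parkingIdeal 𝕜)))
      (adjoin_range_X (σ := Fin m) (R := 𝕜))
    rw [AlgHom.map_adjoin, ← Set.range_comp, Algebra.map_top,
      (AlgHom.range_eq_top _).mpr (Ideal.Quotient.mkₐ_surjective 𝕜 _)] at h
    exact h
  have hfg := fg_adjoin_of_finite (R := 𝕜) (Set.finite_range fun i : Fin m =>
    Ideal.Quotient.mk (G.parkingIdeal 𝕜) (X i)) (by rintro _ ⟨i, rfl⟩; exact hint i)
  rw [hadj, Algebra.top_toSubmodule] at hfg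
  have : Module.Finite 𝕜 (MvPolynomial (Fin m) 𝕜 ⧸ G.parkingIdeal 𝕜) := ⟨hfg⟩
  exact IsArtinianRing.of_finite 𝕜 _

theorem isCanonicalMonomial_canonicalExponent (𝕜 : Type*) [Field 𝕜] (hG : G.IsSaturated) :
    IsCanonicalMonomial (G.parkingIdeal 𝕜) G.canonicalExponent := by
  constructor
  · intro c hc
    obtain ⟨T, rfl⟩ := exists_flagExponent_eq hG hc
    rw [← flagExponent_reverse_add hG T]
    exact le_add_self
  · intro c hc
    obtain ⟨T, rfl⟩ := exists_flagExponent_eq hG hc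
    simp only [← flagExponent_reverse_add hG T, add_tsub_cancel_right]
    exact flagExponent_mem_monSoc 𝕜 hG _

theorem hasGenus_parkingIdeal (𝕜 : Type*) [Field 𝕜] (hG : G.IsSaturated) :
    HasGenus (G.parkingIdeal 𝕜) ((G.numEdges : ℤ) - ((m + 1 : ℕ) : ℤ) + 2) := by
  refine ⟨⟨_, flagExponent_mem_monSoc 𝕜 hG (CompleteFlag.ofPerm (Equiv.refl _))⟩, ?_⟩
  intro c hc
  obtain ⟨T, rfl⟩ := exists_flagExponent_eq hG hc
  have := degree_flagExponent_add hG T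
  omega

theorem isRiemannRoch_parkingIdeal (𝕜 : Type*) [Field 𝕜] (hG : G.IsSaturated) :
    IsRiemannRoch (G.parkingIdeal 𝕜) where
  isMonomialIdeal := ⟨_, G.parkingIdeal_eq_span_image 𝕜⟩
  isArtinian := G.isArtinianIdeal_parkingIdeal 𝕜
  isLevel c hc c' hc' := by
    have h := (hasGenus_parkingIdeal 𝕜 hG).2
    have h1 := h c hc
    have h2 := h c' hc'
    omega
  isReflectionInvariant := ⟨_, isCanonicalMonomial_canonicalExponent 𝕜 hG⟩

theorem bijOn_flagExponent (𝕜 : Type*) [Field 𝕜] (hG : G.IsSaturated) :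
    Set.BijOn G.flagExponent Set.univ (monSoc (G.parkingIdeal 𝕜)) :=
  ⟨fun T _ => flagExponent_mem_monSoc 𝕜 hG T, (flagExponent_injective hG).injOn,
    fun _ hc => (exists_flagExponent_eq hG hc).imp fun _ h => ⟨trivial, h⟩⟩

/-! ### The toppling ideal and its initial ideal -/

theorem laplacian_mulVec {n : ℕ} (G : Multigraph n) (z : Fin n → ℤ) (i : Fin n) :
    G.laplacian.mulVec z i = ∑ j, (G.mult i j : ℤ) * (z i - z j) := by
  have h : ∀ j, G.laplacian i j * z j =
      (if i = j then (G.degree i : ℤ) * z j else 0) - (G.mult i j : ℤ) * z j := by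
    intro j
    by_cases hij : i = j
    · subst hij
      simp [laplacian, G.loopless]
    · simp [laplacian, hij]
  simp only [Matrix.mulVec, dotProduct, h, Finset.sum_sub_distrib, mul_sub, Finset.sum_ite_eq,
    Finset.mem_univ, if_true, ← Finset.sum_mul]
  simp [degree]

theorem mem_laplacianLattice {n : ℕ} {G : Multigraph n} {v : Fin n → ℤ} :
    v ∈ G.laplacianLattice ↔ ∃ z : Fin n → ℤ, ∀ i, v i = ∑ j, (G.mult i j : ℤ) * (z i - z j) := by
  simp only [laplacianLattice, LinearMap.mem_range, Matrix.mulVecLin_apply]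
  refine exists_congr fun z => ?_
  rw [funext_iff]
  exact forall_congr' fun i => by rw [laplacian_mulVec, eq_comm]

/-- The summands `u_ij (z_i - z_j)` are antisymmetric in `i` and `j`. Consequently exponents in one
class have equal degree, and only the tie-break of the term order matters. -/
theorem sum_eq_zero_of_mem_laplacianLattice {n : ℕ} {G : Multigraph n} {v : Fin n → ℤ}
    (hv : v ∈ G.laplacianLattice) : ∑ i, v i = 0 := by
  obtain ⟨z, hz⟩ := mem_laplacianLattice.mp hv
  have h : ∑ i, v i = -∑ i, v i := by
    simp only [hz]
    conv_lhs => rw [Finset.sum_comm]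
    simp only [← Finset.sum_neg_distrib]
    refine Finset.sum_congr rfl fun i _ => Finset.sum_congr rfl fun j _ => ?_
    rw [G.symm j i]
    ring
  omega

/-- The class of an exponent vector modulo the Laplacian lattice. -/
def latticeClass {n : ℕ} (G : Multigraph n) :
    (Fin n →₀ ℕ) →+ (Fin n → ℤ) ⧸ G.laplacianLattice where
  toFun u := Submodule.Quotient.mk fun i => (u i : ℤ)
  map_zero' := by
    rw [Submodule.Quotient.mk_eq_zero]
    exact G.laplacianLattice.zero_mem
  map_add' u v := by
    rw [← Submodule.Quotient.mk_add]
    congr 1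

theorem latticeClass_eq_iff {n : ℕ} {G : Multigraph n} {u v : Fin n →₀ ℕ} :
    G.latticeClass u = G.latticeClass v ↔
      (fun i => (u i : ℤ) - (v i : ℤ)) ∈ G.laplacianLattice :=
  Submodule.Quotient.eq _

open Classical in
/-- The sum of the coefficients of a polynomial in the toppling ideal over a class of exponents
modulo the Laplacian lattice vanishes. -/
theorem sum_coeff_eq_zero_of_mem_topplingIdeal {𝕜 : Type*} [Field 𝕜] {n : ℕ} {G : Multigraph n}
    {f : MvPolynomial (Fin n) 𝕜} (hf : f ∈ G.topplingIdeal 𝕜) (a : Fin n →₀ ℕ) :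
    (∑ b ∈ f.support, if G.latticeClass b = G.latticeClass a then f.coeff b else 0) = 0 := by
  -- The algebra map to the group algebra of the quotient by the lattice kills the generating
  -- binomials. The sum over a class is a coefficient of the image.
  let ψ : MvPolynomial (Fin n) 𝕜 →ₐ[𝕜] AddMonoidAlgebra 𝕜 ((Fin n → ℤ) ⧸ G.laplacianLattice) :=
    AddMonoidAlgebra.mapDomainAlgHom 𝕜 𝕜 G.latticeClass
  have hψ : ∀ u (r : 𝕜), ψ (monomial u r) = AddMonoidAlgebra.single (G.latticeClass u) r :=
    fun u r => AddMonoidAlgebra.mapDomain_single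
  have hker : G.topplingIdeal 𝕜 ≤ RingHom.ker ψ := by
    refine Ideal.span_le.mpr ?_
    rintro _ ⟨u, v, huv, rfl⟩
    rw [SetLike.mem_coe, RingHom.mem_ker, map_sub, hψ, hψ, latticeClass_eq_iff.mpr huv, sub_self]
  have h0 : ψ f = 0 := hker hf
  rw [f.as_sum, map_sum] at h0
  have h1 := congrArg (fun g => g.coeff (G.latticeClass a)) h0
  simpa [hψ, Finsupp.single_apply] using h1

/-- Two exponents in the same class, the first one restricting to a parking function, differ in
the last coordinate, where the first one is larger. -/
theorem last_lt_last_of_isParking (hG : G.IsSaturated) {a b : Fin (m + 1) →₀ ℕ}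
    (hab : (fun i => (a i : ℤ) - (b i : ℤ)) ∈ G.laplacianLattice) (hne : a ≠ b)
    (ha : ∀ I : Finset (Fin m), I.Nonempty → ∃ j ∈ I, a j.castSucc < G.cutExponent I j) :
    b (Fin.last m) < a (Fin.last m) := by
  obtain ⟨z, hz⟩ := mem_laplacianLattice.mp hab
  have hterm : ∀ i, (∀ j, z j ≤ z i) → ∀ j, 0 ≤ (G.mult i j : ℤ) * (z i - z j) :=
    fun i hi j => mul_nonneg (Int.natCast_nonneg _) (sub_nonneg.mpr (hi j))
  -- Maximum principle: otherwise the set where `z` is maximal avoids the last node. At each of its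
  -- nodes `a - b` is at least the cut exponent, since every edge leaving the set contributes at
  -- least one. As `b ≥ 0`, this contradicts `ha`.
  have hlast : ∀ i, z i ≤ z (Fin.last m) := by
    obtain ⟨t, ht⟩ := Finite.exists_max z
    by_contra! hcon
    obtain ⟨i, hi⟩ := hcon
    have htl : z (Fin.last m) < z t := hi.trans_le (ht i)
    have htne : t ≠ Fin.last m := fun h => by simp [h] at htl
    obtain ⟨j, hj, hlt⟩ := ha (Finset.univ.filter fun j => z j.castSucc = z t)
      ⟨t.castPred htne, by simp⟩
    have hj' : z j.castSucc = z t := by simpa using hj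
    rw [← not_le] at hlt
    apply hlt
    have hzj := hz j.castSucc
    have hjmax : ∀ k, z k ≤ z j.castSucc := fun k => hj' ▸ ht k
    have hle : ((G.cutExponent (Finset.univ.filter fun j => z j.castSucc = z t) j : ℕ) : ℤ) ≤
        ∑ k, (G.mult j.castSucc k : ℤ) * (z j.castSucc - z k) := by
      have hcut : G.cutExponent (Finset.univ.filter fun j => z j.castSucc = z t) j =
          ∑ k ∈ ((Finset.univ.filter fun j : Fin m => z j.castSucc = z t).map
            Fin.castSuccEmb)ᶜ, G.mult j.castSucc k := by
        rw [G.cutExponent_of_mem hj, sum_compl_map_castSucc]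
      rw [hcut, Nat.cast_sum]
      refine (Finset.sum_le_sum fun k hk => ?_).trans
        (Finset.sum_le_univ_sum_of_nonneg (hterm _ hjmax))
      have hkt : z k < z j.castSucc := by
        refine lt_of_le_of_ne (hjmax k) fun h => ?_
        rcases Fin.eq_castSucc_or_eq_last k with ⟨k, rfl⟩ | rfl
        · refine Finset.mem_compl.mp hk (Finset.mem_map.mpr ⟨k, ?_, rfl⟩)
          simpa using h.trans hj'
        · exact htl.ne (h.trans hj')
      nlinarith [Int.natCast_nonneg (G.mult j.castSucc k)]
    omega
  by_contra! hle
  -- At the last node `a - b` is a sum of nonnegative terms. If it is not positive, all of them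
  -- vanish, so by saturation `z` is constant and `a = b`.
  have hzl := hz (Fin.last m)
  have hnn := fun j (_ : j ∈ Finset.univ) => hterm _ hlast j
  have hzero := (Finset.sum_eq_zero_iff_of_nonneg hnn).mp
    (le_antisymm (by omega) (Finset.sum_nonneg hnn))
  have hconst : ∀ j, z j = z (Fin.last m) := by
    intro j
    by_cases hj : j = Fin.last m
    · rw [hj]
    have hpos := hG _ _ (Ne.symm hj)
    rcases mul_eq_zero.mp (hzero j (Finset.mem_univ j)) with h | h
    · omega
    · omega
  refine hne (Finsupp.ext fun i => ?_)
  have := hz i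
  simp only [hconst, sub_self, mul_zero, Finset.sum_const_zero] at this
  omega

variable (G) in
/-- The exponent of `x^{[n] \ I → I}`. -/
noncomputable def coCutExponent (I : Finset (Fin m)) : Fin (m + 1) →₀ ℕ :=
  Finsupp.equivFunOnFinite.symm fun i =>
    if i ∈ I.map Fin.castSuccEmb then 0 else ∑ k ∈ I.map Fin.castSuccEmb, G.mult i k

theorem mapDomain_cutExponent (I : Finset (Fin m)) (i : Fin (m + 1)) :
    (G.cutExponent I).mapDomain Fin.castSucc i =
      if i ∈ I.map Fin.castSuccEmb then ∑ k ∈ (I.map Fin.castSuccEmb)ᶜ, G.mult i k else 0 := by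
  rcases Fin.eq_castSucc_or_eq_last i with ⟨i, rfl⟩ | rfl
  · rw [Finsupp.mapDomain_apply (Fin.castSucc_injective m)]
    simp [cutExponent]
  · rw [Finsupp.mapDomain_of_notMem_range, if_neg]
    · simp [Fin.castSucc_ne_last]
    · rintro ⟨k, hk⟩
      exact Fin.castSucc_ne_last k hk

/-- The difference is the Laplacian applied to the indicator vector of `I`. -/
theorem cutExponent_sub_coCutExponent_mem (I : Finset (Fin m)) :
    (fun i => ((G.cutExponent I).mapDomain Fin.castSucc i : ℤ) - (G.coCutExponent I i : ℤ)) ∈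
      G.laplacianLattice := by
  set J := I.map Fin.castSuccEmb with hJ
  refine mem_laplacianLattice.mpr ⟨fun i => if i ∈ J then 1 else 0, fun i => ?_⟩
  rw [mapDomain_cutExponent]
  simp only [coCutExponent, Finsupp.equivFunOnFinite_symm_apply_apply, ← hJ]
  by_cases hi : i ∈ J
  · simp only [hi, if_true, Nat.cast_zero, sub_zero, Nat.cast_sum]
    rw [← Finset.sum_add_sum_compl J, Finset.sum_eq_zero (s := J), zero_add]
    · refine Finset.sum_congr rfl fun k hk => ?_
      simp [Finset.mem_compl.mp hk]
    · intro k hk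
      simp [hk]
  · simp only [hi, if_false, Nat.cast_zero, zero_sub, Nat.cast_sum]
    rw [← Finset.sum_add_sum_compl J, Finset.sum_eq_zero (s := Jᶜ), add_zero,
      ← Finset.sum_neg_distrib]
    · refine Finset.sum_congr rfl fun k hk => ?_
      simp [hk]
    · intro k hk
      simp [Finset.mem_compl.mp hk]

theorem degree_eq_of_sub_mem_laplacianLattice {n : ℕ} {G : Multigraph n} {a b : Fin n →₀ ℕ}
    (h : (fun i => (a i : ℤ) - (b i : ℤ)) ∈ G.laplacianLattice) : a.degree = b.degree := by
  have h' := sum_eq_zero_of_mem_laplacianLattice h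
  rw [Finset.sum_sub_distrib, sub_eq_zero] at h'
  rw [Finsupp.degree_eq_sum, Finsupp.degree_eq_sum]
  exact_mod_cast h'

theorem revLexLT_of_last_lt {τ : Equiv.Perm (Fin (m + 1))} (hτ : τ (Fin.last m) = Fin.last m)
    {a b : Fin (m + 1) →₀ ℕ} (hd : a.degree = b.degree) (h : b (Fin.last m) < a (Fin.last m)) :
    RevLexLT τ a b :=
  Or.inr ⟨hd, Fin.last m, h, fun j hj => absurd hj (by rw [hτ]; exact (Fin.le_last _).not_gt)⟩

theorem last_le_of_revLexLT {τ : Equiv.Perm (Fin (m + 1))} (hτ : τ (Fin.last m) = Fin.last m)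
    {a b : Fin (m + 1) →₀ ℕ} (hd : a.degree = b.degree) (h : RevLexLT τ a b) :
    b (Fin.last m) ≤ a (Fin.last m) := by
  rcases h with h | ⟨-, i, hi, hj⟩
  · omega
  · by_cases hil : i = Fin.last m
    · exact hil ▸ hi.le
    · refine (hj _ ?_).ge
      rw [hτ]
      exact Fin.lt_last_iff_ne_last.mpr fun h => hil (τ.injective (h.trans hτ.symm))

theorem initialIdeal_topplingIdeal (𝕜 : Type*) [Field 𝕜] (hG : G.IsSaturated)
    {τ : Equiv.Perm (Fin (m + 1))} (hτ : τ (Fin.last m) = Fin.last m) :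
    initialIdeal (RevLexLT τ) (G.topplingIdeal 𝕜) =
      (G.parkingIdeal 𝕜).map
        (rename Fin.castSucc : MvPolynomial (Fin m) 𝕜 →ₐ[𝕜] MvPolynomial (Fin (m + 1)) 𝕜) := by
  apply le_antisymm
  · refine Ideal.span_le.mpr ?_
    rintro _ ⟨f, hf, a, ⟨has, hlead⟩, rfl⟩
    by_cases ha : ∀ I : Finset (Fin m), I.Nonempty → ∃ j ∈ I, a j.castSucc < G.cutExponent I j
    · exfalso
      have hsum := sum_coeff_eq_zero_of_mem_topplingIdeal hf a
      -- No other exponent of `f` lies in the class of `a`: it would have a smaller last coordinate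
      -- and so exceed the leading exponent. The class sum thus reduces to the nonzero leading
      -- coefficient.
      rw [Finset.sum_eq_single_of_mem a has, if_pos rfl] at hsum
      · exact mem_support_iff.mp has hsum
      intro b hb hba
      refine if_neg fun hcl => ?_
      have hlat := latticeClass_eq_iff.mp hcl.symm
      have h1 := last_lt_last_of_isParking hG hlat hba.symm ha
      have h2 := last_le_of_revLexLT hτ (degree_eq_of_sub_mem_laplacianLattice hlat).symm
        (hlead b hb hba)
      omega
    · push Not at ha
      obtain ⟨I, hI, hle⟩ := ha
      have hmem : rename Fin.castSucc (monomial (G.cutExponent I) (1 : 𝕜)) ∈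
          (G.parkingIdeal 𝕜).map (rename Fin.castSucc :
            MvPolynomial (Fin m) 𝕜 →ₐ[𝕜] MvPolynomial (Fin (m + 1)) 𝕜) :=
        Ideal.mem_map_of_mem _ (Ideal.subset_span ⟨I, hI, rfl⟩)
      rw [rename_monomial] at hmem
      refine Ideal.mem_of_dvd _ ?_ hmem
      refine monomial_dvd_monomial.mpr ⟨Or.inr fun i => ?_, dvd_rfl⟩
      rcases Fin.eq_castSucc_or_eq_last i with ⟨i, rfl⟩ | rfl
      · rw [Finsupp.mapDomain_apply (Fin.castSucc_injective m)]
        by_cases hi : i ∈ I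
        · exact hle i hi
        · rw [G.cutExponent_of_notMem hi]
          exact Nat.zero_le _
      · rw [mapDomain_cutExponent, if_neg]
        · exact Nat.zero_le _
        · simp [Fin.castSucc_ne_last]
  · rw [parkingIdeal, Ideal.map_span, Ideal.span_le]
    rintro _ ⟨_, ⟨I, hI, rfl⟩, rfl⟩
    refine Ideal.subset_span ⟨_, Ideal.subset_span
      ⟨_, _, G.cutExponent_sub_coCutExponent_mem I, rfl⟩, (G.cutExponent I).mapDomain Fin.castSucc,
      ?_, rename_monomial _ _ _⟩
    have hl : Fin.last m ∉ I.map Fin.castSuccEmb := by simp [Fin.castSucc_ne_last]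
    -- Saturation and `I` nonempty give the second term of the binomial a positive exponent at the
    -- last variable, while the first has none there.
    have hlt : (G.cutExponent I).mapDomain Fin.castSucc (Fin.last m) <
        G.coCutExponent I (Fin.last m) := by
      rw [mapDomain_cutExponent, if_neg hl]
      simp only [coCutExponent, Finsupp.equivFunOnFinite_symm_apply_apply, if_neg hl]
      refine Finset.sum_pos (fun k hk => hG _ _ fun h => hl (h ▸ hk)) (hI.map)
    have hne : G.coCutExponent I ≠ (G.cutExponent I).mapDomain Fin.castSucc :=
      fun h => hlt.ne' (DFunLike.congr_fun h _)
    constructor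
    · simp [mem_support_iff, coeff_sub, coeff_monomial, hne]
    · intro b hb hba
      have hb' : b = G.coCutExponent I := by
        by_contra h
        simp [mem_support_iff, coeff_sub, coeff_monomial, Ne.symm h, Ne.symm hba] at hb
      subst hb'
      exact revLexLT_of_last_lt hτ
        (degree_eq_of_sub_mem_laplacianLattice (G.cutExponent_sub_coCutExponent_mem I)).symm hlt

end Multigraph

end MonomialRR

theorem mainTheorem4 {𝕜 : Type*} [Field 𝕜] (m : ℕ) (G : MonomialRR.Multigraph (m + 1))
    (hG : G.IsSaturated) :
    -- `M_G` is the initial ideal of the toppling ideal for every reverse lexicographic order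
    -- whose smallest variable is the last one
    (∀ τ : Equiv.Perm (Fin (m + 1)), τ (Fin.last m) = Fin.last m →
      MonomialRR.initialIdeal (MonomialRR.RevLexLT τ) (G.topplingIdeal 𝕜) =
        (G.parkingIdeal 𝕜).map
          (MvPolynomial.rename Fin.castSucc :
            MvPolynomial (Fin m) 𝕜 →ₐ[𝕜] MvPolynomial (Fin (m + 1)) 𝕜)) ∧
    -- `M_G` is Riemann-Roch, with the stated canonical monomial and genus `e - n + 2`
    MonomialRR.IsRiemannRoch (G.parkingIdeal 𝕜) ∧
    MonomialRR.IsCanonicalMonomial (G.parkingIdeal 𝕜) G.canonicalExponent ∧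
    MonomialRR.HasGenus (G.parkingIdeal 𝕜) ((G.numEdges : ℤ) - ((m + 1 : ℕ) : ℤ) + 2) ∧
    -- the socle monomials correspond to the complete flags, and the involution reverses the flag
    Set.BijOn G.flagExponent Set.univ (MonomialRR.monSoc (G.parkingIdeal 𝕜)) ∧
    ∀ T : MonomialRR.CompleteFlag m,
      G.flagExponent T.reverse + G.flagExponent T = G.canonicalExponent := by
  exact ⟨fun _ hτ => MonomialRR.Multigraph.initialIdeal_topplingIdeal 𝕜 hG hτ,
    MonomialRR.Multigraph.isRiemannRoch_parkingIdeal 𝕜 hG,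
    MonomialRR.Multigraph.isCanonicalMonomial_canonicalExponent 𝕜 hG,
    MonomialRR.Multigraph.hasGenus_parkingIdeal 𝕜 hG,
    MonomialRR.Multigraph.bijOn_flagExponent 𝕜 hG,
    MonomialRR.Multigraph.flagExponent_reverse_add hG⟩
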